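/- Let $\Sigma=\{a,b\}$ with $a<b$, let $\Gamma$ be a finite totally ordered alphabet, let $\mathcal L\subseteq\Sigma^*$ be any set of words, and let $\mu:\Sigma^*\to\Gamma^*$ be a morphism, i.e. $\mu(uv)=\mu(u)\mu(v)$ for all $u,v\in\Sigma^*$. A circular factor of a word $w$ is a (contiguous) factor of one of the $|w|$ rotations of $w$; let $\widetilde{\mathcal F}(\mathcal L)$ denote the set of circular factors of words of $\mathcal L$. A synchronization pair of $u\in\Gamma^*$ on $\mu(\mathcal L)$ is a pair $(u_1,u_2)$ with $u=u_1u_2$ such that, for all $v_1,v_2\in\Gamma^*$ and $f\in\widetilde{\mathcal F}(\mathcal L)$ with $v_1uv_2=\mu(f)$, there are $f_1,f_2\in\widetilde{\mathcal F}(\mathcal L)$ with $f_1f_2=f$, $v_1u_1=\mu(f_1)$ and $u_2v_2=\mu(f_2)$. The morphism $\mu$ is synchronizing with delay $k>0$ for a word $w\in\mu(\mathcal L)$ if every circular factor of $w$ of length at least $k$ admits a synchronization pair on $\mu(\mathcal L)$. It is synchronizing with delay $K>0$ on $\mu(\mathcal L)$ if it is synchronizing with a finite delay for $\mu(x)$ for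 every $x\in\mathcal L$ and $$\sup_{x\in\mathcal L}\ \min\{k>0 : \mu\text{ is synchronizing with delay }k\text{ for }\mu(x)\}\le K .$$ For a word $w$ over a totally ordered alphabet, $\mathsf{bwt}(w)$ is the word obtained by sorting the multiset of the $|w|$ rotations of $w$ lexicographically and concatenating their last letters, and $r(w)$ is the number of maximal equal-letter runs of $\mathsf{bwt}(w)$. Put $\Delta^+_\mu(u)=r(\mu(u))-r(u)$. Lemma. If $\mu$ is synchronizing with delay $k>0$ on $\mu(\mathcal L)$, then there exists an integer $k'>0$ such that $\Delta^+_\mu(u)\le k'$ for all $u\in\mathcal L$. -/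

import Mathlib

namespace BWTRuns

/-- The image `μ(w)` of a word `w` under a morphism `μ : Σ* → Γ*` of free monoids. -/
def image {α β : Type*} (μ : FreeMonoid α →* FreeMonoid β) (w : List α) : List β :=
  FreeMonoid.toList (μ (FreeMonoid.ofList w))

/-- The multiset of all `|w|` rotations of `w`. -/
def rotations {α : Type*} (w : List α) : Multiset (List α) :=
  (Multiset.range w.length).map w.rotate

/-- The set of circular factors of a word: the factors (contiguous blocks) of its rotations. -/
def circFactors {α : Type*} (w : List α) : Set (List α) :=
  {u | ∃ v ∈ rotations w, u <:+: v}

/-- The set of circular factors of a language. -/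
def circFactorsLang {α : Type*} (L : Set (List α)) : Set (List α) :=
  ⋃ w ∈ L, circFactors w

/-- The Burrows–Wheeler transform: sort the rotations of `w` lexicographically
and read off the last letter of each of them. -/
def bwt {α : Type*} [LinearOrder α] (w : List α) : List α :=
  ((rotations w).sort (· ≤ ·)).filterMap List.getLast?

/-- The number of equal-letter runs of a word, that is, the length of its run-length encoding:
deleting every letter that equals its predecessor keeps exactly one letter of each run. -/
def numRuns {α : Type*} [DecidableEq α] (w : List α) : ℕ :=
  (w.destutter (· ≠ ·)).length

/-- `r(w)`, the number of equal-letter runs of the Burrows–Wheeler transform of `w`. -/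
def bwtRuns {α : Type*} [LinearOrder α] (w : List α) : ℕ :=
  numRuns (bwt w)

/-- The additive increase `r(μ(w)) - r(w)`, an integer that may be negative. -/
def deltaPlus {α β : Type*} [LinearOrder α] [LinearOrder β]
    (μ : FreeMonoid α →* FreeMonoid β) (w : List α) : ℤ :=
  (bwtRuns (image μ w) : ℤ) - (bwtRuns w : ℤ)

/-- `(u₁, u₂)` is a synchronization pair of `u` on `μ(L)`. -/
def IsSyncPair {α β : Type*} (μ : FreeMonoid α →* FreeMonoid β) (L : Set (List α))
    (u u₁ u₂ : List β) : Prop :=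
  u = u₁ ++ u₂ ∧
    ∀ v₁ v₂ : List β, ∀ f ∈ circFactorsLang L, v₁ ++ u ++ v₂ = image μ f →
      ∃ f₁ ∈ circFactorsLang L, ∃ f₂ ∈ circFactorsLang L,
        f₁ ++ f₂ = f ∧ v₁ ++ u₁ = image μ f₁ ∧ u₂ ++ v₂ = image μ f₂

/-- `μ` is synchronizing with delay `k > 0` for the word `w`, where synchronization pairs are
those on `μ(L)`: every circular factor of `w` of length at least `k` admits one. -/
def SyncDelayWord {α β : Type*} (μ : FreeMonoid α →* FreeMonoid β) (L : Set (List α))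
    (k : ℕ) (w : List β) : Prop :=
  0 < k ∧ ∀ u ∈ circFactors w, k ≤ u.length → ∃ u₁ u₂, IsSyncPair μ L u u₁ u₂

/-- The minimal delay with which `μ` is synchronizing for the word `w`
(`⊤` if there is none). -/
noncomputable def minDelay {α β : Type*} (μ : FreeMonoid α →* FreeMonoid β) (L : Set (List α))
    (w : List β) : ℕ∞ :=
  ⨅ (k : ℕ) (_ : SyncDelayWord μ L k w), (k : ℕ∞)

/-- `μ` is synchronizing with delay `K > 0` on `μ(L)`: it is synchronizing with a finite delay
for the image of each word of `L`, and the supremum of the minimal delays is at most `K`. -/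
def SyncDelay {α β : Type*} (μ : FreeMonoid α →* FreeMonoid β) (L : Set (List α))
    (K : ℕ) : Prop :=
  0 < K ∧ (∀ x ∈ L, ∃ k, SyncDelayWord μ L k (image μ x)) ∧
    ⨆ x ∈ L, minDelay μ L (image μ x) ≤ (K : ℕ∞)

end BWTRuns

namespace BWTRuns

/-! For nonempty `w`, r(w) is one more than the number of changes: pairs of lexicographically
consecutive distinct rotations with different last letters (`bwtRuns_eq`). So all but boundedly many
changes of μ(u) have to be charged to changes of u.

If μ(a) and μ(b) commute, μ(u) has boundedly many distinct rotations (`bwtRuns_image_le_of_comm`).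
Otherwise long images of words starting with a and with b agree on a fixed word Z and then differ
(`exists_prefix`); symmetrically, long images of words ending in a and in b share a fixed longest
common suffix S (`exists_suffix`). When μ(u) is long, Z makes μ strictly monotone or strictly
antitone on the rotations of u, and moving S from the end to the front preserves this.

Changes of μ(u) whose rotations differ in their first k letters are boundedly many
(`ncard_changes_take_ne_le`). If both rotations share a prefix p of length k, a synchronization pair
cuts both at the same place of p. The resulting preimages, rotated so as to end where they last
differ, end in different letters, and the two given rotations are their images with S moved to the
front. Consecutive words pull back to consecutive words, so these changes inject into those of u
(`ncard_changes_take_eq_le`). -/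

/-! ### Runs of the transform as changes between consecutive rotations -/

/-- The pairs of consecutive words of `S`, in lexicographic order, that end with distinct letters. -/
def changes {α : Type*} [LinearOrder α] (S : Set (List α)) : Set (List α × List α) :=
  {p | p.1 ∈ S ∧ p.2 ∈ S ∧ p.1 < p.2 ∧ (∀ z ∈ S, p.1 < z → ¬ z < p.2) ∧
    p.1.getLast? ≠ p.2.getLast?}

theorem changes_subset {α : Type*} [LinearOrder α] (S : Set (List α)) : changes S ⊆ S ×ˢ S :=
  fun _ h => ⟨h.1, h.2.1⟩

theorem changes_insert_of_getLast_eq {α : Type*} [LinearOrder α] {S : Set (List α)} {x y : List α}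
    (hxy : x < y) (hy : y ∈ S) (hS : ∀ z ∈ S, y ≤ z) (hl : x.getLast? = y.getLast?) :
    changes (insert x S) = changes S := by
  ext ⟨p, q⟩
  simp only [changes, Set.mem_ofPred_eq, Set.mem_insert_iff]
  constructor
  · rintro ⟨hp, hq, hpq, hb, hne⟩
    have hq' : q ∈ S := by
      rcases hq with rfl | hq
      · rcases hp with rfl | hp
        · exact absurd hpq (lt_irrefl _)
        · exact absurd (hpq.trans hxy) (not_lt.2 (hS _ hp))
      · exact hq
    rcases hp with rfl | hp
    · rcases (hS q hq').eq_or_lt with rfl | h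
      · exact absurd hl hne
      · exact absurd h (hb y (Or.inr hy) hxy)
    · exact ⟨hp, hq', hpq, fun z hz => hb z (Or.inr hz), hne⟩
  · rintro ⟨hp, hq, hpq, hb, hne⟩
    refine ⟨Or.inr hp, Or.inr hq, hpq, ?_, hne⟩
    rintro z (rfl | hz) h1 h2
    · exact absurd (h1.trans hxy) (not_lt.2 (hS _ hp))
    · exact hb z hz h1 h2

theorem changes_insert_of_getLast_ne {α : Type*} [LinearOrder α] {S : Set (List α)} {x y : List α}
    (hxy : x < y) (hy : y ∈ S) (hS : ∀ z ∈ S, y ≤ z) (hl : x.getLast? ≠ y.getLast?) :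
    changes (insert x S) = insert (x, y) (changes S) := by
  ext ⟨p, q⟩
  simp only [changes, Set.mem_ofPred_eq, Set.mem_insert_iff, Prod.mk.injEq]
  constructor
  · rintro ⟨hp, hq, hpq, hb, hne⟩
    have hq' : q ∈ S := by
      rcases hq with rfl | hq
      · rcases hp with rfl | hp
        · exact absurd hpq (lt_irrefl _)
        · exact absurd (hpq.trans hxy) (not_lt.2 (hS _ hp))
      · exact hq
    rcases hp with rfl | hp
    · rcases (hS q hq').eq_or_lt with rfl | h
      · exact Or.inl ⟨rfl, rfl⟩
      · exact absurd h (hb y (Or.inr hy) hxy)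
    · exact Or.inr ⟨hp, hq', hpq, fun z hz => hb z (Or.inr hz), hne⟩
  · rintro (⟨rfl, rfl⟩ | ⟨hp, hq, hpq, hb, hne⟩)
    · refine ⟨Or.inl rfl, Or.inr hy, hxy, ?_, hl⟩
      rintro z (rfl | hz) h1 h2
      · exact lt_irrefl _ h1
      · exact absurd h2 (not_lt.2 (hS _ hz))
    · refine ⟨Or.inr hp, Or.inr hq, hpq, ?_, hne⟩
      rintro z (rfl | hz) h1 h2
      · exact absurd (h1.trans hxy) (not_lt.2 (hS _ hp))
      · exact hb z hz h1 h2

theorem changes_finite {α : Type*} [LinearOrder α] {S : Set (List α)} (hS : S.Finite) :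
    (changes S).Finite :=
  (hS.prod hS).subset (changes_subset S)

/-- Repeated words create no run, so the sorted list may be replaced by its set of entries. A new
least word adds a change exactly when its last letter differs from that of the old least word. -/
theorem numRuns_filterMap_getLast {α : Type*} [LinearOrder α] (l : List (List α)) (x : List α)
    (hs : (x :: l).Pairwise (· ≤ ·)) (hne : ∀ y ∈ x :: l, y ≠ []) :
    numRuns ((x :: l).filterMap List.getLast?) = (changes {y | y ∈ x :: l}).ncard + 1 := by
  induction l generalizing x with
  | nil =>
    obtain ⟨x, c, rfl⟩ := List.eq_nil_or_concat' x |>.resolve_left (hne x (by simp))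
    have : changes {y | y ∈ [x ++ [c]]} = ∅ := by
      ext ⟨p, q⟩
      simp only [changes, List.mem_singleton, Set.mem_ofPred_eq, Set.mem_empty_iff_false, iff_false]
      rintro ⟨rfl, rfl, h, -⟩
      exact lt_irrefl _ h
    rw [this]
    simp [numRuns]
  | cons y l ih =>
    have ih := ih y hs.tail (fun z hz => hne z (List.mem_cons_of_mem _ hz))
    have hset : {z | z ∈ x :: y :: l} = insert x {z | z ∈ y :: l} := by ext; simp
    have hmin : ∀ z ∈ {z | z ∈ y :: l}, y ≤ z := by
      intro z hz
      rcases List.mem_cons.1 hz with rfl | hz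
      · exact le_rfl
      · exact List.rel_of_pairwise_cons hs.tail hz
    have hxy : x ≤ y := List.rel_of_pairwise_cons hs (by simp)
    have hfin : (changes {z | z ∈ y :: l}).Finite := changes_finite (List.finite_toSet _)
    have hxn := hne x (by simp)
    have hyn := hne y (by simp)
    rw [hset]
    obtain ⟨a, ha⟩ : ∃ a, x.getLast? = some a := ⟨_, List.getLast?_eq_some_getLast hxn⟩
    obtain ⟨b, hb⟩ : ∃ b, y.getLast? = some b := ⟨_, List.getLast?_eq_some_getLast hyn⟩
    rw [List.filterMap_cons_some hb] at ih
    rw [List.filterMap_cons_some ha, List.filterMap_cons_some hb]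
    rw [numRuns, List.destutter_cons'] at ih
    rw [numRuns, List.destutter_cons_cons]
    by_cases hab : a = b
    · subst hab
      rw [if_neg (by simp), ih]
      congr 2
      rcases hxy.eq_or_lt with rfl | h
      · rw [Set.insert_eq_of_mem]; simp
      · rw [changes_insert_of_getLast_eq h (by simp) hmin (ha.trans hb.symm)]
    · have hl : x.getLast? ≠ y.getLast? := by rw [ha, hb]; simpa using hab
      have h : x < y := lt_of_le_of_ne hxy (fun h => hl (by rw [h]))
      rw [if_pos hab, List.length_cons, ih,
        changes_insert_of_getLast_ne h (by simp) hmin hl, Set.ncard_insert_of_notMem _ hfin]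
      rintro ⟨h1, -⟩
      exact absurd h (not_lt.2 (hmin x h1))

theorem mem_rotations {α : Type*} {w v : List α} (hw : w ≠ []) :
    v ∈ rotations w ↔ w ~r v := by
  simp only [rotations, Multiset.mem_map, Multiset.mem_range]
  constructor
  · rintro ⟨n, -, rfl⟩
    exact ⟨n, rfl⟩
  · rintro ⟨n, rfl⟩
    exact ⟨n % w.length, Nat.mod_lt _ (List.length_pos_iff.2 hw), List.rotate_mod _ _⟩

theorem finite_isRotated {α : Type*} (w : List α) : {v | w ~r v}.Finite := by
  refine (List.finite_toSet ((List.range (w.length + 1)).map w.rotate)).subset fun v hv => ?_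
  exact List.isRotated_iff_mem_map_range.1 hv

theorem bwtRuns_eq {α : Type*} [LinearOrder α] {w : List α} (hw : w ≠ []) :
    bwtRuns w = (changes {v | w ~r v}).ncard + 1 := by
  have hmem : ∀ v, v ∈ (rotations w).sort (· ≤ ·) ↔ w ~r v := fun v => by
    rw [Multiset.mem_sort, mem_rotations hw]
  have hsort := (rotations w).pairwise_sort (· ≤ ·)
  rw [bwtRuns, bwt]
  generalize (rotations w).sort (· ≤ ·) = l at hmem hsort
  cases l with
  | nil => exact absurd ((hmem w).2 (List.IsRotated.refl w)) (by simp)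
  | cons x l =>
    rw [numRuns_filterMap_getLast l x hsort]
    · simp only [hmem]
    · rintro y hy rfl
      exact hw (List.isRotated_nil_iff.1 ((hmem []).1 hy))

theorem bwtRuns_le_length {α : Type*} [LinearOrder α] (w : List α) : bwtRuns w ≤ w.length := by
  refine (List.destutter_sublist _ _).length_le.trans ?_
  refine (List.length_filterMap_le _ _).trans ?_
  simp [rotations]

/-! ### First difference of long words over two non-commuting factors -/

/-- The concatenations of copies of `α` and `β`. -/
inductive Gen {Γ : Type*} (α β : List Γ) : List Γ → Prop
  | nil : Gen α β []
  | left {w} : Gen α β w → Gen α β (α ++ w)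
  | right {w} : Gen α β w → Gen α β (β ++ w)

namespace Gen
variable {Γ : Type*} {α β w : List Γ}

theorem symm (h : Gen α β w) : Gen β α w := by
  induction h with
  | nil => exact .nil
  | left _ ih => exact .right ih
  | right _ ih => exact .left ih

theorem of_append {γ : List Γ} (h : Gen α (α ++ γ) w) :
    w = [] ∨ ∃ v, Gen α γ v ∧ w = α ++ v := by
  induction h with
  | nil => exact Or.inl rfl
  | left _ ih =>
    refine Or.inr ?_
    rcases ih with rfl | ⟨v, hv, rfl⟩
    · exact ⟨[], .nil, rfl⟩
    · exact ⟨_, hv.left, rfl⟩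
  | right _ ih =>
    refine Or.inr ?_
    rcases ih with rfl | ⟨v, hv, rfl⟩
    · exact ⟨_, (Gen.nil).right, by simp⟩
    · exact ⟨_, hv.left.right, by simp⟩

end Gen

/-- `Z ++ [c]` and `Z ++ [d]` are prefixes of the long words of `{α, β}*` that begin with the
factor `α` and `β`, respectively. -/
def Splits {Γ : Type*} (α β Z : List Γ) (c d : Γ) : Prop :=
  (∀ w, Gen α β w → α.length + β.length ≤ (α ++ w).length → Z ++ [c] <+: α ++ w) ∧
  (∀ w, Gen α β w → α.length + β.length ≤ (β ++ w).length → Z ++ [d] <+: β ++ w)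

theorem Splits.symm {Γ : Type*} {α β Z : List Γ} {c d : Γ} (h : Splits α β Z c d) :
    Splits β α Z d c :=
  ⟨fun w hw hl => h.2 w hw.symm (by omega), fun w hw hl => h.1 w hw.symm (by omega)⟩

/-- Euclidean step: a nonempty word over {α, αγ} is α followed by a word over {α, γ}. Stripping this
α shortens the words and the length threshold by the same amount. -/
theorem splits_append {Γ : Type*} {α γ Z : List Γ} {c d : Γ} (hγ : γ ≠ [])
    (h : Splits α γ Z c d) : Splits α (α ++ γ) (α ++ Z) c d := by
  have hγ := List.length_pos_iff.2 hγ
  constructor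
  · intro w hw hl
    rcases hw.of_append with rfl | ⟨v, hv, rfl⟩
    · simp only [List.length_append, List.length_nil] at hl; omega
    · rw [List.append_assoc]
      exact (List.prefix_append_right_inj _).2 (h.1 v hv (by simp at hl ⊢; omega))
  · intro w hw hl
    have key : ∀ v, Gen α γ v → α.length + γ.length ≤ (γ ++ v).length →
        α ++ Z ++ [d] <+: α ++ γ ++ v := fun v hv hv' => by
      rw [List.append_assoc, List.append_assoc]
      exact (List.prefix_append_right_inj _).2 (h.2 v hv hv')
    rcases hw.of_append with rfl | ⟨v, hv, rfl⟩
    · refine key [] .nil ?_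
      simp only [List.length_append, List.length_nil] at hl ⊢
      omega
    · exact key _ hv.left (by simp at hl ⊢; omega)

theorem exists_first_difference {Γ : Type*} (α β : List Γ) :
    α <+: β ∨ β <+: α ∨ ∃ Z c d, c ≠ d ∧ Z ++ [c] <+: α ∧ Z ++ [d] <+: β := by
  induction α generalizing β with
  | nil => simp
  | cons a α ih =>
    cases β with
    | nil => simp
    | cons b β =>
      by_cases hab : a = b
      · subst hab
        rcases ih β with h | h | ⟨Z, c, d, hcd, h1, h2⟩
        · exact Or.inl (List.cons_prefix_cons.2 ⟨rfl, h⟩)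
        · exact Or.inr (Or.inl (List.cons_prefix_cons.2 ⟨rfl, h⟩))
        · exact Or.inr (Or.inr ⟨a :: Z, c, d, hcd, List.cons_prefix_cons.2 ⟨rfl, h1⟩,
            List.cons_prefix_cons.2 ⟨rfl, h2⟩⟩)
      · exact Or.inr (Or.inr ⟨[], a, b, hab, by simp, by simp⟩)

/-- Euclid's algorithm on the lengths: while one factor is a prefix of the other it is removed, and
non-commutation is inherited by the remainder. -/
theorem exists_splits {Γ : Type*} (α β : List Γ) (h : α ++ β ≠ β ++ α) :
    ∃ Z c d, c ≠ d ∧ Splits α β Z c d := by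
  induction hn : α.length + β.length using Nat.strong_induction_on generalizing α β with
  | _ n ih =>
    have hα : α ≠ [] := by rintro rfl; simp at h
    have hβ : β ≠ [] := by rintro rfl; simp at h
    have hα' := List.length_pos_iff.2 hα
    have hβ' := List.length_pos_iff.2 hβ
    rcases exists_first_difference α β with ⟨γ, rfl⟩ | ⟨γ, rfl⟩ | ⟨Z, c, d, hcd, h1, h2⟩
    · have hγ : α ++ γ ≠ γ ++ α := fun e => h (by rw [List.append_assoc, ← e])
      obtain ⟨Z, c, d, hcd, hs⟩ := ih _ (by simp at hn; omega) α γ hγ rfl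
      exact ⟨_, c, d, hcd, splits_append (by rintro rfl; simp at hγ) hs⟩
    · have hγ : β ++ γ ≠ γ ++ β := fun e => h (by rw [List.append_assoc, ← e])
      obtain ⟨Z, c, d, hcd, hs⟩ := ih _ (by simp at hn; omega) β γ hγ rfl
      exact ⟨_, d, c, hcd.symm, (splits_append (by rintro rfl; simp at hγ) hs).symm⟩
    · exact ⟨Z, c, d, hcd, fun w _ _ => h1.trans (List.prefix_append _ _),
        fun w _ _ => h2.trans (List.prefix_append _ _)⟩


/-! ### Lexicographic order -/

section Lex
variable {α : Type*} [LinearOrder α]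

theorem append_cons_lt_append_cons (g X Y : List α) {c d : α} (h : c < d) :
    g ++ c :: X < g ++ d :: Y :=
  List.append_left_lt (List.cons_lt_cons_iff.2 (Or.inl h))

theorem exists_of_lt_of_length_eq {x y : List α} (h : x < y) (hl : x.length = y.length) :
    ∃ g c d X Y, x = g ++ c :: X ∧ y = g ++ d :: Y ∧ c < d := by
  induction x generalizing y with
  | nil =>
    cases y with
    | nil => exact absurd h (lt_irrefl _)
    | cons b y => simp at hl
  | cons a x ih =>
    cases y with
    | nil => simp at hl
    | cons b y =>
      rcases List.cons_lt_cons_iff.1 h with hab | ⟨rfl, h'⟩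
      · exact ⟨[], a, b, x, y, rfl, rfl, hab⟩
      · obtain ⟨g, c, d, X, Y, rfl, rfl, hcd⟩ := ih h' (by simpa using hl)
        exact ⟨a :: g, c, d, X, Y, rfl, rfl, hcd⟩

theorem append_lt_append_of_length_eq {x y : List α} (p q : List α) (h : x < y)
    (hl : x.length = y.length) : x ++ p < y ++ q := by
  obtain ⟨g, c, d, X, Y, rfl, rfl, hcd⟩ := exists_of_lt_of_length_eq h hl
  simpa using append_cons_lt_append_cons g (X ++ p) (Y ++ q) hcd

theorem lt_of_append_lt_append {x y : List α} {p : List α} (h : x ++ p < y ++ p)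
    (hl : x.length = y.length) : x < y := by
  rcases lt_trichotomy x y with h' | rfl | h'
  · exact h'
  · exact absurd h (lt_irrefl _)
  · exact absurd h (append_lt_append_of_length_eq p p h' hl.symm).not_gt

theorem lt_of_take_lt_take {x y : List α} (k : ℕ) (h : x.take k < y.take k) : x < y := by
  induction k generalizing x y with
  | zero => simp at h
  | succ k ih =>
    cases x with
    | nil =>
      cases y with
      | nil => simp at h
      | cons b y => simp
    | cons a x =>
      cases y with
      | nil => simp at h
      | cons b y =>
        rw [List.take_succ_cons, List.take_succ_cons, List.cons_lt_cons_iff] at h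
        exact List.cons_lt_cons_iff.2 (h.imp_right fun h => ⟨h.1, ih h.2⟩)

theorem take_le_take {x y : List α} (k : ℕ) (h : x ≤ y) : x.take k ≤ y.take k :=
  le_of_not_gt fun h' => absurd (lt_of_take_lt_take k h') (not_lt.2 h)

/-- Words of `S` with the same `take k` form an interval; a change across two intervals is
determined by the interval that its second word opens. -/
theorem ncard_changes_take_ne_le [Finite α] (S : Set (List α)) (k : ℕ) :
    {p ∈ changes S | p.1.take k ≠ p.2.take k}.ncard ≤ {l : List α | l.length ≤ k}.ncard := by
  refine Set.ncard_le_ncard_of_injOn (fun p => p.2.take k) ?_ ?_ (List.finite_length_le α k)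
  · rintro p -
    simp
  · have key : ∀ p ∈ changes S, ∀ q ∈ changes S, q.1.take k ≠ q.2.take k →
        p.2.take k = q.2.take k → ¬ p.2 < q.2 := by
      rintro p hp q hq hne h hlt
      have hle : p.2 ≤ q.1 := not_lt.1 fun h' => hq.2.2.2.1 _ hp.2.1 h' hlt
      refine hne (le_antisymm (take_le_take k hq.2.2.1.le) ?_)
      rw [← h]
      exact take_le_take k hle
    have key' : ∀ p ∈ changes S, ∀ q ∈ changes S, p.2 = q.2 → ¬ p.1 < q.1 := by
      rintro p hp q hq h hlt
      exact hp.2.2.2.1 _ hq.1 hlt (h ▸ hq.2.2.1)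
    rintro p ⟨hp, hp'⟩ q ⟨hq, hq'⟩ h
    have h2 : p.2 = q.2 := le_antisymm (not_lt.1 (key q hq p hp hp' h.symm))
      (not_lt.1 (key p hp q hq hq' h))
    exact Prod.ext (le_antisymm (not_lt.1 (key' q hq p hp h2.symm)) (not_lt.1 (key' p hp q hq h2)))
      h2

end Lex

/-! ### Images under the morphism, and synchronization -/

section Image
variable {Γ : Type*} (μ : FreeMonoid (Fin 2) →* FreeMonoid Γ)

@[simp] theorem image_nil {σ : Type*} (μ : FreeMonoid σ →* FreeMonoid Γ) : image μ [] = [] :=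
  map_one μ

theorem image_append {σ : Type*} (μ : FreeMonoid σ →* FreeMonoid Γ) (u v : List σ) :
    image μ (u ++ v) = image μ u ++ image μ v :=
  map_mul μ (FreeMonoid.ofList u) (FreeMonoid.ofList v)

theorem image_cons {σ : Type*} (μ : FreeMonoid σ →* FreeMonoid Γ) (e : σ) (v : List σ) :
    image μ (e :: v) = image μ [e] ++ image μ v :=
  image_append μ [e] v

theorem image_isRotated {σ : Type*} (μ : FreeMonoid σ →* FreeMonoid Γ) {u v : List σ}
    (h : u ~r v) : image μ u ~r image μ v := by
  obtain ⟨n, hn, rfl⟩ := List.isRotated_iff_mod.1 h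
  rw [List.rotate_eq_drop_append_take hn]
  nth_rw 1 [← List.take_append_drop n u]
  rw [image_append, image_append]
  exact List.isRotated_append

theorem length_image_eq {σ : Type*} (μ : FreeMonoid σ →* FreeMonoid Γ) {u v : List σ}
    (h : u ~r v) : (image μ u).length = (image μ v).length :=
  (image_isRotated μ h).perm.length_eq

theorem gen_image (u : List (Fin 2)) : Gen (image μ [0]) (image μ [1]) (image μ u) := by
  induction u with
  | nil => simpa using Gen.nil
  | cons e u ih =>
    rw [image_cons μ e u]
    match e with
    | 0 => exact ih.left
    | 1 => exact ih.right

theorem gen_reverse_image (u : List (Fin 2)) :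
    Gen (image μ [0]).reverse (image μ [1]).reverse (image μ u).reverse := by
  induction u using List.reverseRecOn with
  | nil => simpa using Gen.nil
  | append_singleton u e ih =>
    rw [image_append, List.reverse_append]
    match e with
    | 0 => exact ih.left
    | 1 => exact ih.right

theorem injective_cons_pair {c d : Γ} (h : c ≠ d) : Function.Injective ![c, d] := by
  intro i j hij
  fin_cases i <;> fin_cases j <;> simp_all

theorem exists_prefix (h : image μ [0] ++ image μ [1] ≠ image μ [1] ++ image μ [0]) :
    ∃ (Z : List Γ) (c : Fin 2 → Γ), c.Injective ∧ ∀ e u,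
      (image μ [0]).length + (image μ [1]).length ≤ (image μ (e :: u)).length →
        Z ++ [c e] <+: image μ (e :: u) := by
  obtain ⟨Z, c, d, hcd, h0, h1⟩ := exists_splits _ _ h
  refine ⟨Z, ![c, d], injective_cons_pair hcd, fun e u hl => ?_⟩
  rw [image_cons μ e u] at hl ⊢
  match e with
  | 0 => exact h0 _ (gen_image μ u) hl
  | 1 => exact h1 _ (gen_image μ u) hl

theorem exists_suffix (h : image μ [0] ++ image μ [1] ≠ image μ [1] ++ image μ [0]) :
    ∃ (S : List Γ) (c : Fin 2 → Γ), c.Injective ∧ ∀ e u,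
      (image μ [0]).length + (image μ [1]).length ≤ (image μ (u ++ [e])).length →
        c e :: S <:+ image μ (u ++ [e]) := by
  have h' : (image μ [0]).reverse ++ (image μ [1]).reverse ≠
      (image μ [1]).reverse ++ (image μ [0]).reverse := fun e => h (by
    rw [← List.reverse_append, ← List.reverse_append] at e
    exact (List.reverse_injective e).symm)
  obtain ⟨Z, c, d, hcd, h0, h1⟩ := exists_splits _ _ h'
  refine ⟨Z.reverse, ![c, d], injective_cons_pair hcd, fun e u hl => ?_⟩
  rw [← List.reverse_prefix]
  rw [image_append] at hl ⊢
  rw [List.reverse_append, List.reverse_cons, List.reverse_reverse]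
  rw [List.length_append] at hl
  match e with
  | 0 => exact h0 _ (gen_reverse_image μ u) (by simpa [add_comm] using hl)
  | 1 => exact h1 _ (gen_reverse_image μ u) (by simpa [add_comm] using hl)

theorem image_lt_image [LinearOrder Γ] {Z : List Γ} {c : Fin 2 → Γ} {M : ℕ}
    (hZ : ∀ e u, M ≤ (image μ (e :: u)).length → Z ++ [c e] <+: image μ (e :: u))
    {g X Y : List (Fin 2)} {e f : Fin 2} (hef : c e < c f)
    (hl : (image μ (g ++ e :: X)).length = (image μ (g ++ f :: Y)).length)
    (hM : M ≤ (image μ (g ++ e :: X)).length) :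
    image μ (g ++ e :: X) < image μ (g ++ f :: Y) := by
  rw [image_append, image_append] at hl ⊢
  rw [image_append] at hM
  simp only [List.length_append] at hl hM
  -- The image of `e :: X` may be too short to show `Z`. Appending `image μ g` restores the full
  -- length; this common tail is cancelled afterwards.
  obtain ⟨R, hR⟩ := hZ e (X ++ g) (by
    rw [← List.cons_append, image_append, List.length_append]; omega)
  obtain ⟨R', hR'⟩ := hZ f (Y ++ g) (by
    rw [← List.cons_append, image_append, List.length_append]; omega)
  rw [← List.cons_append, image_append] at hR hR'
  refine List.append_left_lt (lt_of_append_lt_append (p := image μ g) ?_ (by omega))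
  rw [← hR, ← hR']
  simpa using append_cons_lt_append_cons Z R R' hef

theorem exists_cut {σ : Type*} (μ : FreeMonoid σ →* FreeMonoid Γ) {N : ℕ}
    (hN : ∀ e, (image μ [e]).length ≤ N) (u : List σ) (A B : List Γ) (h : image μ u = A ++ B) :
    ∃ u₁ u₂ p, u = u₁ ++ u₂ ∧ A = image μ u₁ ++ p ∧ image μ u₂ = p ++ B ∧ p.length ≤ N := by
  induction u generalizing A B with
  | nil =>
    simp only [image_nil, List.nil_eq, List.append_eq_nil_iff] at h
    obtain ⟨rfl, rfl⟩ := h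
    exact ⟨[], [], [], by simp⟩
  | cons e u ih =>
    have h' := h
    rw [image_cons] at h'
    rcases List.append_eq_append_iff.1 h' with ⟨A', rfl, h2⟩ | ⟨B', h1, -⟩
    · obtain ⟨u₁, u₂, p, rfl, rfl, h3, h4⟩ := ih _ _ h2
      exact ⟨e :: u₁, u₂, p, rfl, by rw [image_cons μ e u₁, List.append_assoc], h3, h4⟩
    · refine ⟨[], e :: u, A, rfl, by simp, h, ?_⟩
      have := hN e
      rw [h1, List.length_append] at this
      omega

/-- Moving the cut of the rotation back to a letter boundary gives a rotation of `u` with image `h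
++ p ++ t'`, where `t = t' ++ h`; `hl` keeps `p` clear of `h`. The synchronization pair splits this
rotation inside `p`, and its two halves are swapped. -/
theorem exists_isRotated_of_isSyncPair {σ : Type*} (μ : FreeMonoid σ →* FreeMonoid Γ)
    {L : Set (List σ)} {N : ℕ} (hN : ∀ e, (image μ [e]).length ≤ N) {u : List σ} (hu : u ∈ L)
    (hne : u ≠ []) {p t p₁ p₂ : List Γ} (hx : image μ u ~r p ++ t)
    (hl : p.length + N ≤ (image μ u).length) (hp : IsSyncPair μ L p p₁ p₂) :
    ∃ v, u ~r v ∧ image μ v = p₂ ++ t ++ p₁ := by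
  obtain ⟨A, B, hAB, hr⟩ : ∃ A B, image μ u = A ++ B ∧ B ++ A = p ++ t := by
    obtain ⟨n, hn, hr⟩ := List.isRotated_iff_mod.1 hx
    exact ⟨_, _, (List.take_append_drop n _).symm, (List.rotate_eq_drop_append_take hn).symm.trans hr⟩
  obtain ⟨u₁, u₂, h, rfl, rfl, hB, hhN⟩ := exists_cut μ hN u _ _ hAB
  rw [← List.append_assoc] at hr
  rw [hAB] at hl
  simp only [List.length_append] at hl
  obtain ⟨t', ht', rfl⟩ : ∃ t', B ++ image μ u₁ = p ++ t' ∧ t = t' ++ h := by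
    rcases List.append_eq_append_iff.1 hr with ⟨a, rfl, rfl⟩ | ⟨b, h1, h2⟩
    · simp only [List.length_append] at hl hhN
      have : a = [] := List.eq_nil_of_length_eq_zero (by omega)
      exact ⟨[], by simp [this]⟩
    · exact ⟨b, h1, h2⟩
  have hv : image μ (u₂ ++ u₁) = h ++ p ++ t' := by
    rw [image_append, hB, List.append_assoc, ht', List.append_assoc]
  obtain ⟨rfl, hp⟩ := hp
  have hf : u₂ ++ u₁ ∈ circFactorsLang L :=
    Set.mem_biUnion hu ⟨_, (mem_rotations hne).2 List.isRotated_append, List.infix_refl _⟩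
  obtain ⟨f₁, -, f₂, -, hff, hf₁, hf₂⟩ := hp h t' _ hf hv.symm
  refine ⟨f₂ ++ f₁, (List.isRotated_append (l := u₁)).trans (hff ▸ List.isRotated_append), ?_⟩
  rw [image_append, ← hf₁, ← hf₂]
  simp

end Image


/-! ### Pulling changes back along monotone and antitone maps -/

section Transfer
variable {σ Γ : Type*} [LinearOrder σ] [LinearOrder Γ] {φ : List σ → List Γ} {R : Set (List σ)}
  {B : Set (List Γ × List Γ)} {R' : Set (List Γ)}

theorem ncard_le_ncard_changes_of_strictMonoOn (hR : R.Finite) (hmaps : ∀ z ∈ R, φ z ∈ R')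
    (hφ : StrictMonoOn φ R) (hBR : B ⊆ changes R')
    (hB : ∀ p ∈ B, ∃ x ∈ R, ∃ y ∈ R, φ x = p.1 ∧ φ y = p.2 ∧ x.getLast? ≠ y.getLast?) :
    B.ncard ≤ (changes R).ncard := by
  refine (Set.ncard_le_ncard ?_ ((changes_finite hR).image fun p => (φ p.1, φ p.2))).trans
    (Set.ncard_image_le (changes_finite hR))
  rintro ⟨p, q⟩ hpq
  obtain ⟨x, hx, y, hy, rfl, rfl, hne⟩ := hB _ hpq
  obtain ⟨-, -, hlt, hb, -⟩ := hBR hpq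
  exact ⟨(x, y), ⟨hx, hy, (hφ.lt_iff_lt hx hy).1 hlt,
    fun z hz h1 h2 => hb _ (hmaps z hz) (hφ hx hz h1) (hφ hz hy h2), hne⟩, rfl⟩

theorem ncard_le_ncard_changes_of_strictAntiOn (hR : R.Finite) (hmaps : ∀ z ∈ R, φ z ∈ R')
    (hφ : StrictAntiOn φ R) (hBR : B ⊆ changes R')
    (hB : ∀ p ∈ B, ∃ x ∈ R, ∃ y ∈ R, φ x = p.1 ∧ φ y = p.2 ∧ x.getLast? ≠ y.getLast?) :
    B.ncard ≤ (changes R).ncard := by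
  refine (Set.ncard_le_ncard ?_ ((changes_finite hR).image fun p => (φ p.2, φ p.1))).trans
    (Set.ncard_image_le (changes_finite hR))
  rintro ⟨p, q⟩ hpq
  obtain ⟨x, hx, y, hy, rfl, rfl, hne⟩ := hB _ hpq
  obtain ⟨-, -, hlt, hb, -⟩ := hBR hpq
  exact ⟨(y, x), ⟨hy, hx, (hφ.lt_iff_gt hx hy).1 hlt,
    fun z hz h1 h2 => hb _ (hmaps z hz) (hφ hz hx h2) (hφ hy hz h1), hne.symm⟩, rfl⟩

end Transfer

/-! ### Recovering the common suffix from a change -/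

section Suffix
variable {Γ : Type*}

theorem exists_last_difference {x y : List Γ} (h : x ≠ y) (hl : x.length = y.length) :
    ∃ x₀ e y₀ f g, x = x₀ ++ e :: g ∧ y = y₀ ++ f :: g ∧ e ≠ f := by
  induction x generalizing y with
  | nil => exact absurd (List.eq_nil_of_length_eq_zero hl.symm).symm h
  | cons a x ih =>
    cases y with
    | nil => simp at hl
    | cons b y =>
      by_cases hxy : x = y
      · subst hxy
        exact ⟨[], a, [], b, x, rfl, rfl, fun hab => h (by rw [hab])⟩
      · obtain ⟨x₀, e, y₀, f, g, rfl, rfl, hef⟩ := ih hxy (by simpa using hl)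
        exact ⟨a :: x₀, e, b :: y₀, f, g, rfl, rfl, hef⟩

theorem length_le_of_cons_suffix {m S P Q : List Γ} {c d : Γ} (hcd : c ≠ d) (hm : c :: m <:+ P)
    (hm' : d :: m <:+ Q) (hS : S <:+ P) (hS' : S <:+ Q) : S.length ≤ m.length := by
  by_contra! hlt
  have h1 : c :: m <:+ S := List.suffix_of_suffix_length_le hm hS hlt
  have h2 : d :: m <:+ S := List.suffix_of_suffix_length_le hm' hS' hlt
  have h := (List.suffix_of_suffix_length_le h1 h2 le_rfl).eq_of_length rfl
  exact hcd (List.cons.inj h).1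

/-- Both `m` and `S` are the longest common suffix of `P` and `Q`. -/
theorem eq_of_cons_suffix {m S P Q : List Γ} {c d c' d' : Γ} (hcd : c ≠ d) (hcd' : c' ≠ d')
    (hm : c :: m <:+ P) (hm' : d :: m <:+ Q) (hS : c' :: S <:+ P) (hS' : d' :: S <:+ Q) :
    m = S := by
  have t {a : Γ} {l r : List Γ} (h : a :: l <:+ r) : l <:+ r := (List.suffix_cons a l).trans h
  have h1 := length_le_of_cons_suffix hcd hm hm' (t hS) (t hS')
  have h2 := length_le_of_cons_suffix hcd' hS hS' (t hm) (t hm')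
  exact (List.suffix_of_suffix_length_le (t hm) (t hS) h2).eq_of_length (le_antisymm h2 h1)

theorem exists_isRotated_image_eq_append {σ : Type*} (μ : FreeMonoid σ →* FreeMonoid Γ)
    {S : List Γ} {c : σ → Γ} (hc : c.Injective) {M : ℕ}
    (hS : ∀ e u, M ≤ (image μ (u ++ [e])).length → c e :: S <:+ image μ (u ++ [e]))
    {x y : List σ} {T T' q : List Γ} (hx : image μ x = T ++ q) (hy : image μ y = T' ++ q)
    (hl : x.length = y.length) (hT : T.length = T'.length) (hne : T.getLast? ≠ T'.getLast?)
    (hM : M ≤ (image μ x).length) :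
    ∃ x' y' X Y, x ~r x' ∧ y ~r y' ∧ x'.getLast? ≠ y'.getLast? ∧
      image μ x' = X ++ S ∧ image μ y' = Y ++ S ∧ S ++ X = q ++ T ∧ S ++ Y = q ++ T' := by
  have hxy : x ≠ y := by
    rintro rfl
    exact hne (by rw [List.append_cancel_right (hx.symm.trans hy)])
  obtain ⟨x₀, e, y₀, f, g, rfl, rfl, hef⟩ := exists_last_difference hxy hl
  have hMx := length_image_eq μ (List.isRotated_append (l := x₀ ++ [e]) (l' := g))
  have hMy := length_image_eq μ (List.isRotated_append (l := y₀ ++ [f]) (l' := g))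
  rw [List.append_cons] at hx hy hM ⊢
  rw [List.append_cons y₀ f g]
  rw [← List.append_assoc] at hMx hMy
  have hMy' : (image μ (x₀ ++ [e] ++ g)).length = (image μ (y₀ ++ [f] ++ g)).length := by
    rw [hx, hy, List.length_append, List.length_append, hT]
  obtain ⟨m, hm, hm', rfl⟩ : ∃ m, image μ (x₀ ++ [e]) = T ++ m ∧
      image μ (y₀ ++ [f]) = T' ++ m ∧ q = m ++ image μ g := by
    rw [image_append] at hx hy
    -- Were `image μ g` longer than `q`, the excess would be a common suffix of `T` and `T'`,
    -- against `hne`.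
    rcases List.append_eq_append_iff.1 hx with ⟨m, rfl, hm⟩ | ⟨m, h1, rfl⟩
    · rw [hm, ← List.append_assoc] at hy
      have hy := List.append_cancel_right hy
      rcases m.eq_nil_or_concat' with rfl | ⟨m, a, rfl⟩
      · exact ⟨[], by simp, by simpa using hy, by simpa using hm.symm⟩
      · exact absurd (by rw [← hy, ← List.append_assoc, ← List.append_assoc]; simp) hne
    · rw [← List.append_assoc] at hy
      exact ⟨m, h1, List.append_cancel_right hy, rfl⟩
  have hX : image μ (g ++ x₀ ++ [e]) = image μ g ++ T ++ m := by
    rw [List.append_assoc, image_append, hm, List.append_assoc]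
  have hY : image μ (g ++ y₀ ++ [f]) = image μ g ++ T' ++ m := by
    rw [List.append_assoc, image_append, hm', List.append_assoc]
  have hsx := hS e (g ++ x₀) (hMx ▸ hM)
  have hsy := hS f (g ++ y₀) (hMy ▸ hMy' ▸ hM)
  have hmS : m = S := by
    rcases T.eq_nil_or_concat' with rfl | ⟨T₀, a, rfl⟩
    · exact absurd (by rw [List.eq_nil_of_length_eq_zero hT.symm]) hne
    rcases T'.eq_nil_or_concat' with rfl | ⟨T₁, b, rfl⟩
    · simp at hT
    refine eq_of_cons_suffix (c := a) (d := b) (fun h => hne (by simp [h])) (hc.ne hef) ?_ ?_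
      hsx hsy
    · exact ⟨image μ g ++ T₀, by rw [hX]; simp⟩
    · exact ⟨image μ g ++ T₁, by rw [hY]; simp⟩
  subst hmS
  refine ⟨g ++ x₀ ++ [e], g ++ y₀ ++ [f], _, _, ?_, ?_, by simpa using hef, hX, hY, ?_, ?_⟩
  · rw [List.append_assoc g]; exact List.isRotated_append
  · rw [List.append_assoc g]; exact List.isRotated_append
  · simp
  · simp

end Suffix

/-! ### Charging changes of the image to changes of the word -/

/-- The rotation of `μ(z)` that brings its suffix of length `n` to the front. -/
def rotatedImage {σ Γ : Type*} (μ : FreeMonoid σ →* FreeMonoid Γ) (n : ℕ) (z : List σ) :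
    List Γ :=
  (image μ z).rotate ((image μ z).length - n)

theorem rotatedImage_eq {σ Γ : Type*} {μ : FreeMonoid σ →* FreeMonoid Γ} {z : List σ}
    {X S : List Γ} (h : image μ z = X ++ S) : rotatedImage μ S.length z = S ++ X := by
  rw [rotatedImage, h, List.length_append, Nat.add_sub_cancel, List.rotate_append_length_eq]

section Main
variable {Γ : Type*} (μ : FreeMonoid (Fin 2) →* FreeMonoid Γ)

theorem rotatedImage_lt [LinearOrder Γ] {Z S : List Γ} {c c' : Fin 2 → Γ} {M : ℕ}
    (hZ : ∀ e u, M ≤ (image μ (e :: u)).length → Z ++ [c e] <+: image μ (e :: u))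
    (hS : ∀ e u, M ≤ (image μ (u ++ [e])).length → c' e :: S <:+ image μ (u ++ [e]))
    {x y : List (Fin 2)} {g X Y : List (Fin 2)} {e f : Fin 2} (hx : x = g ++ e :: X)
    (hy : y = g ++ f :: Y) (hef : c e < c f)
    (hl : (image μ x).length = (image μ y).length) (hM : M ≤ (image μ x).length) :
    rotatedImage μ S.length x < rotatedImage μ S.length y := by
  have key : ∀ z, z ≠ [] → M ≤ (image μ z).length → ∃ X, image μ z = X ++ S := by
    intro z hz hzM
    obtain ⟨v, a, rfl⟩ := z.eq_nil_or_concat'.resolve_left hz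
    obtain ⟨X, hX⟩ := (List.suffix_cons _ _).trans (hS a v hzM)
    exact ⟨X, hX.symm⟩
  obtain ⟨P, hP⟩ := key x (by simp [hx]) hM
  obtain ⟨Q, hQ⟩ := key y (by simp [hy]) (hl ▸ hM)
  rw [rotatedImage_eq hP, rotatedImage_eq hQ]
  have hlt : image μ x < image μ y := by
    subst hx hy
    exact image_lt_image μ hZ hef hl hM
  rw [hP, hQ] at hlt hl
  -- At equal lengths, the order survives removing the common suffix `S` and putting it in front.
  exact List.append_left_lt (lt_of_append_lt_append hlt (by simpa using hl))

theorem ncard_changes_take_eq_le [LinearOrder Γ] {L : Set (List (Fin 2))} {k N : ℕ}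
    (h : image μ [0] ++ image μ [1] ≠ image μ [1] ++ image μ [0])
    (hN : ∀ e, (image μ [e]).length ≤ N) {u : List (Fin 2)} (hu : u ∈ L)
    (hne : u ≠ []) (hk : k + N ≤ (image μ u).length)
    (hM : (image μ [0]).length + (image μ [1]).length ≤ (image μ u).length)
    (hsync : ∀ p ∈ circFactors (image μ u), k ≤ p.length → ∃ p₁ p₂, IsSyncPair μ L p p₁ p₂) :
    {p ∈ changes {v | image μ u ~r v} | p.1.take k = p.2.take k}.ncard ≤
      (changes {v | u ~r v}).ncard := by
  obtain ⟨Z, c, hc, hZ⟩ := exists_prefix μ h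
  obtain ⟨S, c', hc', hS⟩ := exists_suffix μ h
  have hmaps : ∀ z ∈ {v | u ~r v}, rotatedImage μ S.length z ∈ {v | image μ u ~r v} :=
    fun z hz => (image_isRotated μ hz).trans ⟨_, rfl⟩
  -- On two letters the first difference is always 0 against 1, so the order of `c 0` and `c 1`
  -- alone decides between monotone and antitone.
  have hdec : ∀ x ∈ {v | u ~r v}, ∀ y ∈ {v | u ~r v}, x < y →
      ∃ g X Y, x = g ++ 0 :: X ∧ y = g ++ 1 :: Y := by
    intro x hx y hy hxy
    obtain ⟨g, e, f, X, Y, rfl, rfl, hef⟩ := exists_of_lt_of_length_eq hxy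
      ((List.IsRotated.symm hx).trans hy).perm.length_eq
    obtain rfl : e = 0 := by omega
    obtain rfl : f = 1 := by omega
    exact ⟨g, X, Y, rfl, rfl⟩
  have hB : ∀ p ∈ {p ∈ changes {v | image μ u ~r v} | p.1.take k = p.2.take k},
      ∃ x ∈ {v | u ~r v}, ∃ y ∈ {v | u ~r v}, rotatedImage μ S.length x = p.1 ∧
        rotatedImage μ S.length y = p.2 ∧ x.getLast? ≠ y.getLast? := by
    rintro ⟨x, y⟩ ⟨⟨hx, hy, -, -, hlast⟩, hxy⟩
    simp only at hx hy hxy hlast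
    have hlx : (image μ u).length = x.length := hx.perm.length_eq
    have hly : (image μ u).length = y.length := hy.perm.length_eq
    have hlp : (x.take k).length = k := by rw [List.length_take]; omega
    have hx' := x.take_append_drop k
    have hy' := y.take_append_drop k
    rw [← hxy] at hy'
    generalize x.take k = p at *
    generalize x.drop k = t at *
    generalize y.drop k = t' at *
    subst hx' hy'
    have hwne : image μ u ≠ [] := by
      intro h0
      rw [h0, List.length_nil] at hlx hly
      have h1 := List.eq_nil_of_length_eq_zero hlx.symm
      have h2 := List.eq_nil_of_length_eq_zero hly.symm
      exact hlast (by rw [h1, h2])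
    obtain ⟨p₁, p₂, hp⟩ := hsync p
      ⟨_, (mem_rotations hwne).2 hx, (List.prefix_append _ _).isInfix⟩ hlp.ge
    obtain ⟨x₀, hux, hx₀⟩ := exists_isRotated_of_isSyncPair μ hN hu hne hx (by omega) hp
    obtain ⟨y₀, huy, hy₀⟩ := exists_isRotated_of_isSyncPair μ hN hu hne hy (by omega) hp
    obtain ⟨rfl, -⟩ := hp
    have hTl : t.length = t'.length := by
      have := hlx.symm.trans hly
      simp only [List.length_append] at this
      omega
    obtain ⟨x₁, y₁, X, Y, hxx, hyy, hl, hX, hY, hXT, hYT⟩ := exists_isRotated_image_eq_append μ hc'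
      hS hx₀ hy₀ ((hux.symm).trans huy).perm.length_eq (by simpa using hTl)
      (fun h => hlast (by
        rw [List.append_assoc, List.append_assoc, List.getLast?_append, h, ← List.getLast?_append]))
      (length_image_eq μ hux ▸ hM)
    refine ⟨x₁, hux.trans hxx, y₁, huy.trans hyy, ?_, ?_⟩
    · exact (rotatedImage_eq hX).trans (hXT.trans (List.append_assoc _ _ _).symm)
    · exact ⟨(rotatedImage_eq hY).trans (hYT.trans (List.append_assoc _ _ _).symm), hl⟩
  have hlen : ∀ x ∈ {v | u ~r v}, (image μ x).length = (image μ u).length :=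
    fun x hx => (length_image_eq μ hx).symm
  rcases (hc.ne (show (0 : Fin 2) ≠ 1 by decide)).lt_or_gt with hlt | hlt
  · refine ncard_le_ncard_changes_of_strictMonoOn (finite_isRotated u) hmaps ?_
      (fun p hp => hp.1) hB
    intro x hx y hy hxy
    obtain ⟨g, X, Y, hgx, hgy⟩ := hdec x hx y hy hxy
    exact rotatedImage_lt μ hZ hS hgx hgy hlt ((hlen x hx).trans (hlen y hy).symm)
      (hlen x hx ▸ hM)
  · refine ncard_le_ncard_changes_of_strictAntiOn (finite_isRotated u) hmaps ?_
      (fun p hp => hp.1) hB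
    intro x hx y hy hxy
    obtain ⟨g, X, Y, hgx, hgy⟩ := hdec x hx y hy hxy
    exact rotatedImage_lt μ hZ hS hgy hgx hlt ((hlen y hy).trans (hlen x hx).symm)
      (hlen y hy ▸ hM)

/-! ### Commuting letter images -/

theorem image_append_comm (h : image μ [0] ++ image μ [1] = image μ [1] ++ image μ [0])
    (u v : List (Fin 2)) : image μ u ++ image μ v = image μ v ++ image μ u := by
  have h2 : ∀ e f : Fin 2, image μ [e] ++ image μ [f] = image μ [f] ++ image μ [e] := by
    intro e f
    match e, f with
    | 0, 0 => rfl
    | 0, 1 => exact h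
    | 1, 0 => exact h.symm
    | 1, 1 => rfl
  have h1 : ∀ e v, image μ [e] ++ image μ v = image μ v ++ image μ [e] := by
    intro e v
    induction v with
    | nil => simp
    | cons f v ih =>
      rw [image_cons μ f v, ← List.append_assoc, h2, List.append_assoc, ih, List.append_assoc]
  induction u with
  | nil => simp
  | cons e u ih =>
    rw [image_cons μ e u, List.append_assoc, ih, ← List.append_assoc, h1, List.append_assoc]

theorem ncard_isRotated_le {w : List Γ} {n : ℕ} (hn : 0 < n) (h : w.rotate n = w) :
    {v | w ~r v}.ncard ≤ n := by
  have hmul : ∀ m, w.rotate (n * m) = w := by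
    intro m
    induction m with
    | zero => simp
    | succ m ih => rw [Nat.mul_succ, ← List.rotate_rotate, ih, h]
  have hsub : {v | w ~r v} ⊆ w.rotate '' (Finset.range n : Set ℕ) := by
    rintro _ ⟨m, rfl⟩
    refine ⟨m % n, by simpa using Nat.mod_lt _ hn, ?_⟩
    conv_rhs => rw [← Nat.div_add_mod m n, ← List.rotate_rotate, hmul]
  refine (Set.ncard_le_ncard hsub ((Finset.finite_toSet _).image _)).trans ?_
  refine (Set.ncard_image_le (Finset.finite_toSet _)).trans ?_
  rw [Set.ncard_coe_finset, Finset.card_range]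

/-- Rotating a nonempty `image μ u` by the length of a nonempty image of a letter of `u` fixes it,
which leaves at most `N` distinct rotations and `N * N` pairs. -/
theorem bwtRuns_image_le_of_comm [LinearOrder Γ]
    (h : image μ [0] ++ image μ [1] = image μ [1] ++ image μ [0]) {N : ℕ}
    (hN : ∀ e, (image μ [e]).length ≤ N) (u : List (Fin 2)) :
    bwtRuns (image μ u) ≤ N * N + 1 := by
  by_cases hw : image μ u = []
  · rw [hw]
    exact (bwtRuns_le_length _).trans (by simp)
  obtain ⟨e, he, hpos⟩ : ∃ e ∈ u, image μ [e] ≠ [] := by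
    by_contra! hall
    refine hw ?_
    clear hw
    induction u with
    | nil => simp
    | cons e u ih =>
      rw [image_cons μ e u, hall e (by simp), ih fun f hf => hall f (List.mem_cons_of_mem _ hf)]
      rfl
  obtain ⟨u₁, u₂, rfl⟩ := List.append_of_mem he
  have hrot : (image μ (u₁ ++ e :: u₂)).rotate (image μ [e]).length = image μ (u₁ ++ e :: u₂) := by
    rw [image_append, image_append_comm μ h, ← image_append, List.cons_append, image_cons,
      List.rotate_append_length_eq, image_append_comm μ h]
  have hcard := (ncard_isRotated_le (List.length_pos_iff.2 hpos) hrot).trans (hN e)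
  rw [bwtRuns_eq hw]
  refine Nat.succ_le_succ ((Set.ncard_le_ncard (changes_subset _)
    ((finite_isRotated _).prod (finite_isRotated _))).trans ?_)
  rw [Set.ncard_prod]
  exact Nat.mul_le_mul hcard hcard

theorem exists_isSyncPair_of_syncDelay {σ : Type*} {μ : FreeMonoid σ →* FreeMonoid Γ}
    {L : Set (List σ)} {k : ℕ} (hμ : SyncDelay μ L k) {u : List σ} (hu : u ∈ L) {p : List Γ}
    (hp : p ∈ circFactors (image μ u)) (hk : k ≤ p.length) :
    ∃ p₁ p₂, IsSyncPair μ L p p₁ p₂ := by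
  by_contra hcon
  have hle : minDelay μ L (image μ u) ≤ k := (le_iSup₂ (f := fun x (_ : x ∈ L) =>
    minDelay μ L (image μ x)) u hu).trans hμ.2.2
  -- A bad factor of length at least `k` excludes every delay up to `k`.
  have hge : ((k + 1 : ℕ) : ℕ∞) ≤ minDelay μ L (image μ u) := by
    refine le_iInf₂ fun j hj => ?_
    rw [Nat.cast_le]
    by_contra! hlt
    exact hcon (hj.2 p hp (by omega))
  have := Nat.cast_le.1 (hge.trans hle)
  omega

end Main

end BWTRuns

theorem mainTheorem7 {Γ : Type*} [LinearOrder Γ] [Finite Γ]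
    (L : Set (List (Fin 2))) (μ : FreeMonoid (Fin 2) →* FreeMonoid Γ)
    (k : ℕ) (hμ : BWTRuns.SyncDelay μ L k) :
    ∃ k' : ℕ, 0 < k' ∧ ∀ u ∈ L, BWTRuns.deltaPlus μ u ≤ (k' : ℤ) := by
  open BWTRuns in
  set N := (image μ [0]).length + (image μ [1]).length with hNdef
  have hN : ∀ e, (image μ [e]).length ≤ N := by
    intro e
    match e with
    | 0 => exact Nat.le_add_right _ _
    | 1 => exact Nat.le_add_left _ _
  by_cases h : image μ [0] ++ image μ [1] = image μ [1] ++ image μ [0]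
  · refine ⟨N * N + 1, Nat.succ_pos _, fun u _ => ?_⟩
    have := bwtRuns_image_le_of_comm μ h hN u
    rw [deltaPlus]
    omega
  -- The first term bounds the changes with distinct prefixes, `k + N` covers the images too short
  -- for the argument, and 1 ensures positivity.
  · refine ⟨{l : List Γ | l.length ≤ k}.ncard + (k + N) + 1, Nat.succ_pos _, fun u hu => ?_⟩
    rw [deltaPlus]
    by_cases hlen : k + N ≤ (image μ u).length
    · have hwne : image μ u ≠ [] := by
        have := hμ.1
        exact List.ne_nil_of_length_pos (by omega)
      have hune : u ≠ [] := by
        rintro rfl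
        simp at hwne
      have h1 := ncard_changes_take_ne_le {v | image μ u ~r v} k
      have h2 := ncard_changes_take_eq_le μ h hN hu hune hlen (by omega)
        fun p => exists_isSyncPair_of_syncDelay hμ hu
      have h3 : (changes {v | image μ u ~r v}).ncard ≤
          {p ∈ changes {v | image μ u ~r v} | p.1.take k = p.2.take k}.ncard +
          {p ∈ changes {v | image μ u ~r v} | p.1.take k ≠ p.2.take k}.ncard := by
        refine le_trans (Set.ncard_le_ncard ?_ ?_) (Set.ncard_union_le _ _)
        · intro p hp
          exact (em (p.1.take k = p.2.take k)).imp (⟨hp, ·⟩) (⟨hp, ·⟩)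
        · have hfin := changes_finite (finite_isRotated (image μ u))
          exact (hfin.subset fun p hp => hp.1).union (hfin.subset fun p hp => hp.1)
      rw [bwtRuns_eq hwne, bwtRuns_eq hune]
      omega
    · have := bwtRuns_le_length (image μ u)
      omega
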